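/- **Theorem (finiteness).** Let $c,\delta\in\mathbb{R}$ and let $Y_n=X_n+cn$, $n\ge 1$ (the linear drift model, LDM), where $(X_n)_{n\ge1}$ are i.i.d. real random variables with an absolutely continuous distribution, cumulative distribution function $F$ and density $f$. Assume that there are $-\infty\le x_-<x_+\le\infty$ such that $f(x)>0$ for all $x\in(x_-,x_+)$ and $f(x)=0$ otherwise, and put $\mu^+=\int_0^\infty x f(x)\,dx\in[0,\infty]$. Call $Y_j$ a $\delta$-record if $j=1$, or if $j\ge2$ and $Y_j>\max\{Y_1,\dots,Y_{j-1}\}+\delta$; let $N_{n,\delta}$ be the number of $\delta$-records among $Y_1,\dots,Y_n$, and let $N_{\infty,\delta}=\lim_{n\to\infty}N_{n,\delta}\in[0,\infty]$. Then $N_{\infty,\delta}<\infty$ almost surely if and only if one of the following conditions holds: 1. $c<0$ and $\mu^+<\infty$; 2. $c=0$, $\delta>0$ and $\displaystyle\int_0^\infty \frac{1-F(x+\delta)}{(1-F(x))^2}\,f(x)\,dx<\infty$, where the integrand is read as $0$ where $f(x)=0$; 3. $c>0$ and $x_+-x_-\le\delta-c$. Moreover, $N_{\infty,\delta}<\infty$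 almost surely if and only if $\mathbb{E}[N_{\infty,\delta}]<\infty$. -/

import Mathlib

open MeasureTheory ProbabilityTheory Set
open scoped ENNReal

/-- The linear drift model built on `X` with trend `c`. Sequences `(Zₖ)_{k ≥ 1}` are indexed from `0`:
`X n` is the `(n+1)`-th variable, so the `(n+1)`-th observation is `X n + c (n + 1)`. -/
def linearDrift {Ω : Type*} (X : ℕ → Ω → ℝ) (c : ℝ) (n : ℕ) (ω : Ω) : ℝ :=
  X n ω + c * ((n : ℝ) + 1)

/-- The observation `y n` is a `δ`-record: it exceeds `max {y 0, …, y (n-1)} + δ`, that is, it exceeds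
`y i + δ` for every earlier `i`. The first observation `y 0` is a `δ`-record by convention. -/
def IsDeltaRecord (δ : ℝ) (y : ℕ → ℝ) (n : ℕ) : Prop :=
  ∀ i < n, y i + δ < y n

open Classical in
/-- The number of `δ`-records among the first `n` terms of `y`. -/
noncomputable def deltaRecordCount (δ : ℝ) (y : ℕ → ℝ) (n : ℕ) : ℕ :=
  ∑ j ∈ Finset.range n, if IsDeltaRecord δ y j then 1 else 0

/-- The total number of `δ`-records of `y`, in `[0, ∞]`: the limit, which is the supremum,
of the nondecreasing sequence of counts. -/
noncomputable def totalDeltaRecords (δ : ℝ) (y : ℕ → ℝ) : ℝ≥0∞ :=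
  ⨆ n, (deltaRecordCount δ y n : ℝ≥0∞)

/-- The right-tail expectation `μ⁺ = ∫₀^∞ x f(x) dx` in `[0, ∞]` of a density `f`. -/
noncomputable def rightTailExpectation (f : ℝ → ℝ) : ℝ≥0∞ :=
  ∫⁻ x in Ioi (0 : ℝ), ENNReal.ofReal (x * f x)

/-! ### Deterministic facts on `δ`-records -/

/-! Everything reduces to whether the expected number of records is finite. After a record at `i`,
the later observations form a copy of the model, up to a constant shift, independent of that record.
If at most `m` records occur in total with probability `q > 0`, then the probabilities `p i` of a
record at `i` satisfy `∑ p i * q ≤ m + 1`. So finiteness with positive probability already gives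
finite expectation (`lintegral_totalDeltaRecords_lt_top`), and the converse direction is immediate.
Conditioning on the last variable turns `p n` into the integral of a product of values of the
distribution function (`measure_isDeltaRecord`).

For `c < 0` the two Borel–Cantelli lemmas decide: a finite `μ⁺` makes the drift beat the variables,
and an infinite one makes the observations unbounded above. For `c > 0`, either the support is so
short that no step exceeds `δ`, or `p n` stays bounded away from `0` (an infinite `μ⁺` is treated by
lowering the drift). For `c = 0` the products are powers, and the geometric series gives the
expectation as `∫ (1 - F(y - δ))⁻¹ dF(y)`. It diverges like `∫ du / (1 - u)` if `δ ≤ 0`; if `δ > 0`,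
writing `1/(1 - F)` as an integral of `dF/(1 - F)²` and applying Tonelli produces the stated
integral. -/

theorem deltaRecordCount_eq_sum_indicator (δ : ℝ) (y : ℕ → ℝ) (n : ℕ) :
    (deltaRecordCount δ y n : ℝ≥0∞) =
      ∑ j ∈ Finset.range n, {k | IsDeltaRecord δ y k}.indicator (fun _ => (1 : ℝ≥0∞)) j := by
  classical
  unfold deltaRecordCount
  push_cast
  refine Finset.sum_congr rfl fun j _ => ?_
  by_cases h : IsDeltaRecord δ y j <;> simp [h]

theorem totalDeltaRecords_eq_tsum (δ : ℝ) (y : ℕ → ℝ) :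
    totalDeltaRecords δ y =
      ∑' n, {k | IsDeltaRecord δ y k}.indicator (fun _ => (1 : ℝ≥0∞)) n := by
  rw [ENNReal.tsum_eq_iSup_nat]
  simp only [totalDeltaRecords, deltaRecordCount_eq_sum_indicator]

theorem totalDeltaRecords_eq_encard (δ : ℝ) (y : ℕ → ℝ) :
    totalDeltaRecords δ y = ({k | IsDeltaRecord δ y k}.encard : ℝ≥0∞) := by
  rw [totalDeltaRecords_eq_tsum, ← tsum_subtype, ENNReal.tsum_set_one]

theorem totalDeltaRecords_lt_top_iff {δ : ℝ} {y : ℕ → ℝ} :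
    totalDeltaRecords δ y < ∞ ↔ {k | IsDeltaRecord δ y k}.Finite := by
  rw [totalDeltaRecords_eq_encard, ← Set.encard_lt_top_iff, ← ENat.toENNReal_top,
    ENat.toENNReal_lt]

theorem totalDeltaRecords_mono {δ δ' : ℝ} {y y' : ℕ → ℝ}
    (h : ∀ n, IsDeltaRecord δ y n → IsDeltaRecord δ' y' n) :
    totalDeltaRecords δ y ≤ totalDeltaRecords δ' y' := by
  rw [totalDeltaRecords_eq_encard, totalDeltaRecords_eq_encard]
  exact_mod_cast Set.encard_le_encard h

theorem isDeltaRecord_add_const {δ a : ℝ} {y : ℕ → ℝ} {n : ℕ} :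
    IsDeltaRecord δ (fun k => y k + a) n ↔ IsDeltaRecord δ y n :=
  forall₂_congr fun i _ => by constructor <;> intro h <;> linarith

/-- A record of a sequence is a record of each of its tails. -/
theorem IsDeltaRecord.tail {δ : ℝ} {y : ℕ → ℝ} {i k : ℕ} (h : IsDeltaRecord δ y (i + k)) :
    IsDeltaRecord δ (fun l => y (i + l)) k :=
  fun l hl => h (i + l) (by omega)

/-- At most `m + 1` records have a subsequent tail with at most `m` records. -/
theorem sum_indicator_record_tail_le (δ : ℝ) (y : ℕ → ℝ) (m n : ℕ) :
    ∑ i ∈ Finset.range n, {i | IsDeltaRecord δ y i ∧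
      totalDeltaRecords δ (fun k => y (i + 1 + k)) ≤ m}.indicator (fun _ => (1 : ℝ≥0∞)) i
      ≤ m + 1 := by
  classical
  set A : Set ℕ := {i | IsDeltaRecord δ y i ∧ totalDeltaRecords δ (fun k => y (i + 1 + k)) ≤ m}
    with hA
  set S : Finset ℕ := (Finset.range n).filter (· ∈ A) with hS
  have hsum : ∑ i ∈ Finset.range n, A.indicator (fun _ => (1 : ℝ≥0∞)) i = S.card := by
    simp only [Set.indicator_apply, hS]
    rw [Finset.sum_boole]
  rw [hsum]
  rcases S.eq_empty_or_nonempty with h | h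
  · simp [h]
  -- All other members of `S` are records of the tail after the least one, and that tail has at most
  -- `m` records.
  set i := S.min' h with hi
  have hiS : i ∈ S := S.min'_mem h
  have hiA : i ∈ A := (Finset.mem_filter.1 hiS).2
  have hcard : ((S.erase i).card : ℝ≥0∞) ≤ m := by
    refine le_trans ?_ hiA.2
    rw [totalDeltaRecords_eq_encard]
    have hinj : Set.InjOn (fun j => j - (i + 1)) (S.erase i : Finset ℕ) := by
      intro a ha b hb hab
      have ha' := S.min'_lt_of_mem_erase_min' h (Finset.mem_coe.1 ha)
      have hb' := S.min'_lt_of_mem_erase_min' h (Finset.mem_coe.1 hb)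
      simp only at hab
      omega
    have hsub : (fun j => j - (i + 1)) '' (S.erase i : Finset ℕ) ⊆
        {k | IsDeltaRecord δ (fun k => y (i + 1 + k)) k} := by
      rintro _ ⟨j, hj, rfl⟩
      have hj' : i < j := S.min'_lt_of_mem_erase_min' h (Finset.mem_coe.1 hj)
      have hjA : j ∈ A := (Finset.mem_filter.1 (Finset.mem_of_mem_erase hj)).2
      refine IsDeltaRecord.tail (y := y) ?_
      have : i + 1 + (j - (i + 1)) = j := by omega
      rw [this]
      exact hjA.1
    have h1 := Set.encard_le_encard hsub
    rw [hinj.encard_image, Set.encard_coe_eq_coe_finsetCard] at h1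
    have h2 := ENat.toENNReal_le.2 h1
    simpa using h2
  rw [← Finset.card_erase_add_one hiS]
  push_cast
  gcongr

/-- If every initial segment is eventually exceeded, there are infinitely many records. -/
theorem infinite_isDeltaRecord {δ : ℝ} (hδ : δ ≤ 0) {y : ℕ → ℝ}
    (h : ∀ N, ∃ n, ∀ i ≤ N, y i < y n) : {k | IsDeltaRecord δ y k}.Infinite := by
  classical
  refine Set.infinite_of_not_bddAbove ?_
  rintro ⟨N, hN⟩
  have hex := h N
  -- By minimality every index before `n` is dominated by one of the first `N + 1` values, all of
  -- which `y n` exceeds.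
  set n := Nat.find hex with hn
  have hspec : ∀ i ≤ N, y i < y n := Nat.find_spec hex
  have hNn : N < n := by
    by_contra hcon
    exact lt_irrefl _ (hspec n (not_lt.1 hcon))
  have hrec : IsDeltaRecord δ y n := by
    intro i hi
    have hyi : y i < y n := by
      have := Nat.find_min hex hi
      push Not at this
      obtain ⟨k, hk, hki⟩ := this
      exact lt_of_le_of_lt hki (hspec k hk)
    linarith
  exact absurd (hN hrec) (not_le.2 hNn)

theorem IsDeltaRecord.linearDrift_mono {Ω : Type*} {X : ℕ → Ω → ℝ} {c c' δ : ℝ} (hc : c ≤ c')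
    {ω : Ω} {n : ℕ} (h : IsDeltaRecord δ (fun k => linearDrift X c k ω) n) :
    IsDeltaRecord δ (fun k => linearDrift X c' k ω) n := by
  intro i hi
  have h1 := h i hi
  simp only [linearDrift] at h1 ⊢
  have : (i : ℝ) < n := by exact_mod_cast hi
  nlinarith

/-! ### Expected number of records -/

section Probability

variable {Ω : Type*}

theorem totalDeltaRecords_eq_tsum_indicator (Y : ℕ → Ω → ℝ) (δ : ℝ) (ω : Ω) :
    totalDeltaRecords δ (fun k => Y k ω) =
      ∑' n, {ω | IsDeltaRecord δ (fun k => Y k ω) n}.indicator (fun _ => (1 : ℝ≥0∞)) ω := by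
  rw [totalDeltaRecords_eq_tsum]
  rfl

variable [MeasurableSpace Ω]

theorem measurable_linearDrift {X : ℕ → Ω → ℝ} (hX : ∀ n, Measurable (X n)) (c : ℝ) (n : ℕ) :
    Measurable (linearDrift X c n) :=
  (hX n).add_const _

theorem measurableSet_isDeltaRecord {Y : ℕ → Ω → ℝ} (hY : ∀ n, Measurable (Y n)) (δ : ℝ)
    (n : ℕ) : MeasurableSet {ω | IsDeltaRecord δ (fun k => Y k ω) n} := by
  simp only [IsDeltaRecord, ofPred_forall]
  exact MeasurableSet.iInter fun i => MeasurableSet.iInter fun _ =>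
    measurableSet_lt ((hY i).add_const δ) (hY n)

theorem measurable_totalDeltaRecords {Y : ℕ → Ω → ℝ} (hY : ∀ n, Measurable (Y n)) (δ : ℝ) :
    Measurable fun ω => totalDeltaRecords δ (fun k => Y k ω) := by
  simp only [totalDeltaRecords_eq_tsum_indicator Y]
  exact Measurable.tsum fun n =>
    measurable_const.indicator (measurableSet_isDeltaRecord hY δ n)

theorem lintegral_totalDeltaRecords (μ : Measure Ω) {Y : ℕ → Ω → ℝ}
    (hY : ∀ n, Measurable (Y n)) (δ : ℝ) :
    ∫⁻ ω, totalDeltaRecords δ (fun k => Y k ω) ∂μ =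
      ∑' n, μ {ω | IsDeltaRecord δ (fun k => Y k ω) n} := by
  simp only [totalDeltaRecords_eq_tsum_indicator Y]
  rw [lintegral_tsum fun n =>
    (measurable_const.indicator (measurableSet_isDeltaRecord hY δ n)).aemeasurable]
  refine tsum_congr fun n => ?_
  rw [lintegral_indicator (measurableSet_isDeltaRecord hY δ n)]
  simp

/-! ### Independence of the past and the tail -/

variable {μ : Measure Ω} {X : ℕ → Ω → ℝ} {ν : Measure ℝ}

theorem ProbabilityTheory.iIndepFun.indepFun_tail [IsProbabilityMeasure μ] (hX : ∀ n, Measurable (X n))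
    (hindep : iIndepFun X μ) (i : ℕ) :
    IndepFun (fun ω (k : Finset.range i) => X k ω) (fun ω k => X (i + k) ω) μ := by
  refine IndepFun.indepFun_process (measurable_pi_lambda _ fun k => hX k) (fun k => hX _)
    fun I => ?_
  have h := hindep.indepFun_finset (Finset.range i) (I.image (i + ·)) (by
    rw [Finset.disjoint_left]
    intro a ha hb
    simp only [Finset.mem_range, Finset.mem_image] at ha hb
    omega) hX
  exact h.comp (φ := id)
    (ψ := fun (z : (I.image (i + ·) : Finset ℕ) → ℝ) (k : I) =>
      z ⟨i + k, Finset.mem_image_of_mem _ k.2⟩) measurable_id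
    (measurable_pi_lambda _ fun k => measurable_pi_apply _)

theorem map_tail_eq (hX : ∀ n, Measurable (X n)) (hindep : iIndepFun X μ)
    (hlaw : ∀ n, μ.map (X n) = ν) (i : ℕ) :
    μ.map (fun ω k => X (i + k) ω) = μ.map (fun ω k => X k ω) := by
  have hinj : Function.Injective (fun k => i + k) := add_right_injective i
  rw [(hindep.precomp hinj).map_fun_eq_infinitePi_map (fun k => hX _),
    hindep.map_fun_eq_infinitePi_map hX]
  simp only [hlaw]

/-- A record at `i` depends on the variables up to `i`, the tail count only on those after it. The
tail is again a drift model, translated by a constant that does not affect records, so its count has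
the original law. -/
theorem measure_isDeltaRecord_inter_tail [IsProbabilityMeasure μ]
    (hX : ∀ n, Measurable (X n)) (hindep : iIndepFun X μ)
    (hlaw : ∀ n, μ.map (X n) = ν) (c δ : ℝ) (i : ℕ) (a : ℝ≥0∞) :
    μ {ω | IsDeltaRecord δ (fun k => linearDrift X c k ω) i ∧
      totalDeltaRecords δ (fun k => linearDrift X c (i + 1 + k) ω) ≤ a} =
    μ {ω | IsDeltaRecord δ (fun k => linearDrift X c k ω) i} *
      μ {ω | totalDeltaRecords δ (fun k => linearDrift X c k ω) ≤ a} := by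
  have hcoord : ∀ n, Measurable (fun x : ℕ → ℝ => x n) := fun n => measurable_pi_apply n
  set B : Set (ℕ → ℝ) :=
    {x | totalDeltaRecords δ (fun k => linearDrift (fun n (x : ℕ → ℝ) => x n) c k x) ≤ a} with hB
  have hBm : MeasurableSet B :=
    measurable_totalDeltaRecords (measurable_linearDrift hcoord c) δ measurableSet_Iic
  set A : Set (Finset.range (i + 1) → ℝ) :=
    {z | ∀ l (hl : l < i), z ⟨l, by simp; omega⟩ + c * ((l : ℝ) + 1) + δ <
      z ⟨i, by simp⟩ + c * ((i : ℝ) + 1)} with hA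
  have hAm : MeasurableSet A := by
    simp only [hA, ofPred_forall]
    refine MeasurableSet.iInter fun l => MeasurableSet.iInter fun hl =>
      measurableSet_lt ?_ ?_ <;> fun_prop
  have h1 := (hindep.indepFun_tail hX (i + 1)).measure_inter_preimage_eq_mul A B hAm hBm
  have hpA : (fun ω (k : Finset.range (i + 1)) => X k ω) ⁻¹' A =
      {ω | IsDeltaRecord δ (fun k => linearDrift X c k ω) i} := by
    ext ω
    simp [hA, IsDeltaRecord, linearDrift]
  have hpB : (fun ω k => X (i + 1 + k) ω) ⁻¹' B =
      {ω | totalDeltaRecords δ (fun k => linearDrift X c (i + 1 + k) ω) ≤ a} := by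
    ext ω
    have : totalDeltaRecords δ (fun k => linearDrift X c (i + 1 + k) ω) = totalDeltaRecords δ
        (fun k => linearDrift (fun n (x : ℕ → ℝ) => x n) c k (fun k => X (i + 1 + k) ω)) := by
      have hshift : (fun k => linearDrift X c (i + 1 + k) ω) = fun k =>
          linearDrift (fun n (x : ℕ → ℝ) => x n) c k (fun k => X (i + 1 + k) ω) +
            c * (i + 1) := by
        funext k
        simp only [linearDrift]
        push_cast
        ring
      rw [hshift]
      exact le_antisymm (totalDeltaRecords_mono fun n => isDeltaRecord_add_const.1)
        (totalDeltaRecords_mono fun n => isDeltaRecord_add_const.2)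
    simp only [hB, mem_preimage, mem_ofPred_eq, this]
  have hlawB : μ ((fun ω k => X (i + 1 + k) ω) ⁻¹' B) =
      μ {ω | totalDeltaRecords δ (fun k => linearDrift X c k ω) ≤ a} := by
    rw [← Measure.map_apply (measurable_pi_lambda _ fun k => hX _) hBm,
      map_tail_eq hX hindep hlaw, Measure.map_apply (measurable_pi_lambda _ fun k => hX _) hBm]
    rfl
  rw [hlawB, hpA, hpB] at h1
  exact h1

variable [IsProbabilityMeasure μ]

/-- If the number of records is finite with positive probability, it is integrable. -/
theorem lintegral_totalDeltaRecords_lt_top (hX : ∀ n, Measurable (X n))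
    (hindep : iIndepFun X μ) (hlaw : ∀ n, μ.map (X n) = ν) (c δ : ℝ)
    (h : μ {ω | totalDeltaRecords δ (fun k => linearDrift X c k ω) < ∞} ≠ 0) :
    ∫⁻ ω, totalDeltaRecords δ (fun k => linearDrift X c k ω) ∂μ < ∞ := by
  have hY := measurable_linearDrift hX c
  obtain ⟨m, hm⟩ : ∃ m : ℕ, μ {ω | totalDeltaRecords δ (fun k => linearDrift X c k ω) ≤ m} ≠ 0 := by
    by_contra! hcon
    refine h (measure_mono_null ?_ (measure_iUnion_null hcon))
    intro ω hω
    obtain ⟨m, hm⟩ := ENNReal.exists_nat_gt (ne_of_lt hω)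
    exact mem_iUnion.2 ⟨m, hm.le⟩
  set q := μ {ω | totalDeltaRecords δ (fun k => linearDrift X c k ω) ≤ m} with hq
  have hset : ∀ i, MeasurableSet {ω | IsDeltaRecord δ (fun k => linearDrift X c k ω) i ∧
      totalDeltaRecords δ (fun k => linearDrift X c (i + 1 + k) ω) ≤ m} := fun i =>
    (measurableSet_isDeltaRecord hY δ i).inter
      (measurable_totalDeltaRecords (fun k => hY (i + 1 + k)) δ measurableSet_Iic)
  -- Each summand is the probability of a record at `i` followed by a tail with at most `m` records;
  -- at most `m + 1` such events occur together.
  have hbound : (∑' i, μ {ω | IsDeltaRecord δ (fun k => linearDrift X c k ω) i}) * q ≤ m + 1 := by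
    rw [← ENNReal.tsum_mul_right]
    refine ENNReal.tsum_le_of_sum_range_le fun n => ?_
    calc ∑ i ∈ Finset.range n, μ {ω | IsDeltaRecord δ (fun k => linearDrift X c k ω) i} * q
        = ∑ i ∈ Finset.range n, ∫⁻ ω, {ω | IsDeltaRecord δ (fun k => linearDrift X c k ω) i ∧
            totalDeltaRecords δ (fun k => linearDrift X c (i + 1 + k) ω) ≤ m}.indicator
              (fun _ => (1 : ℝ≥0∞)) ω ∂μ := by
          refine Finset.sum_congr rfl fun i _ => ?_
          rw [lintegral_indicator (hset i), setLIntegral_one,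
            measure_isDeltaRecord_inter_tail hX hindep hlaw]
      _ = ∫⁻ ω, ∑ i ∈ Finset.range n, {ω | IsDeltaRecord δ (fun k => linearDrift X c k ω) i ∧
            totalDeltaRecords δ (fun k => linearDrift X c (i + 1 + k) ω) ≤ m}.indicator
              (fun _ => (1 : ℝ≥0∞)) ω ∂μ :=
          (lintegral_finsetSum _ fun i _ => measurable_const.indicator (hset i)).symm
      _ ≤ ∫⁻ _, (m + 1 : ℝ≥0∞) ∂μ :=
          lintegral_mono fun ω =>
            sum_indicator_record_tail_le δ (fun k => linearDrift X c k ω) m n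
      _ = m + 1 := by simp
  rw [lintegral_totalDeltaRecords μ hY]
  refine lt_top_iff_ne_top.2 fun htop => ?_
  rw [htop, ENNReal.top_mul hm] at hbound
  exact absurd hbound (by simp)

theorem lintegral_totalDeltaRecords_eq_top (c δ : ℝ)
    (h : ∀ᵐ ω ∂μ, {k | IsDeltaRecord δ (fun k => linearDrift X c k ω) k}.Infinite) :
    ∫⁻ ω, totalDeltaRecords δ (fun k => linearDrift X c k ω) ∂μ = ∞ := by
  have : ∀ᵐ ω ∂μ, totalDeltaRecords δ (fun k => linearDrift X c k ω) = ∞ := by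
    filter_upwards [h] with ω hω
    by_contra hcon
    exact hω (totalDeltaRecords_lt_top_iff.1 (lt_top_iff_ne_top.2 hcon))
  rw [lintegral_congr_ae this]
  simp

/-- The probability of a record at `n`, obtained by conditioning on the `n`-th variable. -/
theorem measure_isDeltaRecord (hX : ∀ n, Measurable (X n)) (hindep : iIndepFun X μ)
    (hlaw : ∀ n, μ.map (X n) = ν) (c δ : ℝ) (n : ℕ) :
    μ {ω | IsDeltaRecord δ (fun k => linearDrift X c k ω) n} =
      ∫⁻ x, ∏ k ∈ Finset.range n, ν (Iio (x - δ + c * ((k : ℝ) + 1))) ∂ν := by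
  have : IsProbabilityMeasure ν := hlaw 0 ▸ Measure.isProbabilityMeasure_map (hX 0).aemeasurable
  set W : Ω → (Finset.range n → ℝ) := fun ω k => X k ω with hW
  have hWm : Measurable W := measurable_pi_lambda _ fun k => hX k
  have hind : IndepFun (X n) W μ := by
    have h := hindep.indepFun_finset {n} (Finset.range n) (by simp) hX
    exact h.comp (φ := fun z : ({n} : Finset ℕ) → ℝ => z ⟨n, by simp⟩) (ψ := id)
      (measurable_pi_apply _) measurable_id
  set A : Set (ℝ × (Finset.range n → ℝ)) :=
    {p | ∀ j : Finset.range n, p.2 j < p.1 - δ + c * ((n : ℝ) - j)} with hA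
  have hAm : MeasurableSet A := by
    simp only [hA, ofPred_forall]
    refine MeasurableSet.iInter fun j => measurableSet_lt ?_ ?_ <;> fun_prop
  have hpre : {ω | IsDeltaRecord δ (fun k => linearDrift X c k ω) n} =
      (fun ω => (X n ω, W ω)) ⁻¹' A := by
    ext ω
    simp only [IsDeltaRecord, linearDrift, mem_ofPred_eq, hA, mem_preimage, hW, Subtype.forall,
      Finset.mem_range]
    refine forall₂_congr fun j _ => ?_
    constructor <;> intro h <;> linarith
  rw [hpre, ← Measure.map_apply ((hX n).prodMk hWm) hAm,
    (indepFun_iff_map_prod_eq_prod_map_map (hX n).aemeasurable hWm.aemeasurable).1 hind, hlaw n,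
    Measure.prod_apply hAm]
  refine lintegral_congr fun x => ?_
  rw [Measure.map_apply hWm (measurable_prodMk_left hAm)]
  have hinter : W ⁻¹' (Prod.mk x ⁻¹' A) =
      ⋂ j ∈ Finset.range n, X j ⁻¹' Iio (x - δ + c * ((n : ℝ) - j)) := by
    ext ω
    simp [hW, hA]
  rw [hinter, hindep.measure_inter_preimage_eq_mul _ fun _ _ => measurableSet_Iio]
  -- Reindexing by the lag: `j = n - 1 - k` gives `n - j = k + 1`.
  rw [← Finset.prod_range_reflect]
  refine Finset.prod_congr rfl fun k hk => ?_
  have hk' : k + 1 ≤ n := Finset.mem_range.1 hk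
  rw [← Measure.map_apply (hX _) measurableSet_Iio, hlaw]
  congr 3
  rw [Nat.sub_sub, Nat.cast_sub (by omega)]
  push_cast
  ring

end Probability

/-! ### Probability integral transform -/

section ProbabilityIntegralTransform

open Filter Topology

variable (ν : Measure ℝ) [IsProbabilityMeasure ν]

theorem one_sub_ofReal_cdf (x : ℝ) : 1 - ENNReal.ofReal (cdf ν x) = ν (Ioi x) := by
  rw [ofReal_cdf, ← compl_Iic, prob_compl_eq_one_sub measurableSet_Iic]

theorem ofReal_one_sub_cdf (x : ℝ) : ENNReal.ofReal (1 - cdf ν x) = ν (Ioi x) := by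
  rw [← one_sub_ofReal_cdf, ENNReal.ofReal_sub _ (cdf_nonneg ν x), ENNReal.ofReal_one]

theorem continuous_cdf [NullSingletonClass ν] : Continuous (cdf ν) := by
  rw [continuous_iff_continuousAt]
  intro x
  rw [(monotone_cdf ν).continuousAt_iff_leftLim_eq_rightLim, StieltjesFunction.rightLim_eq]
  refine le_antisymm ((monotone_cdf ν).leftLim_le le_rfl) ?_
  have h := (cdf ν).measure_singleton x
  rw [measure_cdf, measure_singleton] at h
  linarith [ENNReal.ofReal_eq_zero.1 h.symm]

/-- By continuity the sublevel set is a closed ray whose endpoint has cdf value exactly `u`; it can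
be empty only if `u = 0`. -/
theorem measure_cdf_le [NullSingletonClass ν] {u : ℝ} (h0 : 0 ≤ u) (h1 : u < 1) :
    ν {x | cdf ν x ≤ u} = ENNReal.ofReal u := by
  have hcont := continuous_cdf ν
  set S := {x | cdf ν x ≤ u} with hS
  have hbdd : BddAbove S := by
    obtain ⟨b, hb⟩ := ((tendsto_cdf_atTop ν).eventually (lt_mem_nhds h1)).exists
    exact ⟨b, fun x hx => le_of_not_gt fun hbx =>
      absurd (monotone_cdf ν hbx.le) (not_le.2 (lt_of_le_of_lt hx hb))⟩
  rcases S.eq_empty_or_nonempty with he | hne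
  · rcases h0.eq_or_lt with rfl | hpos
    · simp [he]
    · obtain ⟨b, hb⟩ := ((tendsto_cdf_atBot ν).eventually (gt_mem_nhds hpos)).exists
      exact absurd (show b ∈ S from hb.le) (by simp [he])
  · have hclosed : IsClosed S := isClosed_le hcont continuous_const
    set t := sSup S with ht
    have htS : t ∈ S := hclosed.csSup_mem hne hbdd
    have hSt : S = Iic t := by
      ext x
      exact ⟨fun hx => le_csSup hbdd hx, fun hx => (monotone_cdf ν hx).trans htS⟩
    have htu : cdf ν t = u := by
      refine le_antisymm htS ?_
      refine ge_of_tendsto (hcont.continuousWithinAt (s := Ioi t)) ?_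
      filter_upwards [self_mem_nhdsWithin] with x hx
      by_contra hcon
      exact absurd (le_csSup hbdd (show x ∈ S from (not_le.1 hcon).le)) (not_le.2 hx)
    rw [hSt, ← ofReal_cdf, htu]

/-- The cdf of an atomless law transports it to the uniform law. -/
theorem map_cdf [NullSingletonClass ν] : ν.map (cdf ν) = volume.restrict (Icc 0 1) := by
  have hm : Measurable (cdf ν) := (continuous_cdf ν).measurable
  have := Measure.isProbabilityMeasure_map (μ := ν) hm.aemeasurable
  refine Measure.ext_of_Iic _ _ fun u => ?_
  rw [Measure.map_apply hm measurableSet_Iic, Measure.restrict_apply measurableSet_Iic]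
  rcases lt_or_ge u 0 with h | h0
  · have h1 : cdf ν ⁻¹' Iic u = ∅ := by
      ext x
      simpa using lt_of_lt_of_le h (cdf_nonneg ν x)
    have h2 : Iic u ∩ Icc (0 : ℝ) 1 = ∅ := by
      ext x
      simp only [mem_inter_iff, mem_Iic, mem_Icc, mem_empty_iff_false, iff_false]
      intro hx
      linarith [hx.1, hx.2.1]
    simp [h1, h2]
  rcases lt_or_ge u 1 with h1 | h1
  · have h2 : Iic u ∩ Icc (0 : ℝ) 1 = Icc 0 u := by
      ext x
      simp only [mem_inter_iff, mem_Iic, mem_Icc]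
      exact ⟨fun hx => ⟨hx.2.1, hx.1⟩, fun hx => ⟨hx.2, hx.1, hx.2.trans h1.le⟩⟩
    rw [h2, Real.volume_Icc, sub_zero]
    exact measure_cdf_le ν h0 h1
  · have h2 : cdf ν ⁻¹' Iic u = univ := by
      ext x
      simpa using (cdf_le_one ν x).trans h1
    have h3 : Iic u ∩ Icc (0 : ℝ) 1 = Icc 0 1 := by
      ext x
      simp only [mem_inter_iff, mem_Iic, mem_Icc]
      exact ⟨fun hx => hx.2, fun hx => ⟨hx.2.trans h1, hx⟩⟩
    simp [h2, h3]

theorem lintegral_comp_cdf [NullSingletonClass ν] {g : ℝ → ℝ≥0∞} (hg : Measurable g) :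
    ∫⁻ x, g (cdf ν x) ∂ν = ∫⁻ u in Icc 0 1, g u := by
  rw [← map_cdf ν, lintegral_map hg (continuous_cdf ν).measurable]

theorem setLIntegral_Iic_comp_cdf [NullSingletonClass ν] {g : ℝ → ℝ≥0∞} (hg : Measurable g) {t : ℝ}
    (ht : cdf ν t < 1) :
    ∫⁻ x in Iic t, g (cdf ν x) ∂ν = ∫⁻ u in Icc 0 (cdf ν t), g u := by
  have hm : Measurable (cdf ν) := (continuous_cdf ν).measurable
  -- The two sets differ by a stretch beyond `t` on which the cdf is flat, a null set.
  have hae : Iic t =ᵐ[ν] cdf ν ⁻¹' Iic (cdf ν t) := by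
    refine ae_eq_of_subset_of_measure_ge (fun x hx => monotone_cdf ν hx) ?_
      measurableSet_Iic.nullMeasurableSet (measure_ne_top _ _)
    rw [← ofReal_cdf]
    exact (measure_cdf_le ν (cdf_nonneg ν t) ht).le
  rw [setLIntegral_congr hae, ← setLIntegral_map measurableSet_Iic hg hm, map_cdf,
    Measure.restrict_restrict measurableSet_Iic]
  congr 2
  ext x
  simp only [mem_inter_iff, mem_Iic, mem_Icc]
  exact ⟨fun hx => ⟨hx.2.1, hx.1⟩, fun hx => ⟨hx.2, hx.1, hx.2.trans ht.le⟩⟩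

theorem setLIntegral_Icc_inv_one_sub_sq {s : ℝ} (h0 : 0 ≤ s) (h1 : s < 1) :
    ∫⁻ u in Icc 0 s, (1 - ENNReal.ofReal u)⁻¹ ^ 2 = ENNReal.ofReal ((1 - s)⁻¹ - 1) := by
  have hderiv : ∀ u ∈ uIcc 0 s, HasDerivAt (fun u : ℝ => (1 - u)⁻¹) (((1 - u)⁻¹) ^ 2) u := by
    intro u hu
    rw [uIcc_of_le h0] at hu
    have hne : 1 - u ≠ 0 := by linarith [hu.2]
    have := ((hasDerivAt_id u).const_sub 1).fun_inv hne
    simpa [neg_div] using this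
  have hcont : ContinuousOn (fun u : ℝ => ((1 - u)⁻¹) ^ 2) (uIcc 0 s) := by
    refine ContinuousOn.pow (ContinuousOn.inv₀ (by fun_prop) fun u hu => ?_) 2
    rw [uIcc_of_le h0] at hu
    linarith [hu.2]
  have hint := intervalIntegral.integral_eq_sub_of_hasDerivAt hderiv hcont.intervalIntegrable
  rw [intervalIntegral.integral_of_le h0, ← integral_Icc_eq_integral_Ioc] at hint
  simp only [sub_zero, inv_one] at hint
  rw [← hint, ofReal_integral_eq_lintegral_ofReal]
  · refine setLIntegral_congr_fun measurableSet_Icc fun u hu => ?_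
    have hpos : 0 < 1 - u := by linarith [hu.2]
    rw [ENNReal.ofReal_pow (inv_nonneg.2 hpos.le), ENNReal.ofReal_inv_of_pos hpos,
      ENNReal.ofReal_sub _ hu.1, ENNReal.ofReal_one]
  · rw [uIcc_of_le h0] at hcont
    exact hcont.integrableOn_compact isCompact_Icc
  · exact Filter.Eventually.of_forall fun u => sq_nonneg _

/-- The fundamental theorem of calculus for `1 / (1 - u)`, pulled back along the cdf. -/
theorem inv_measure_Ioi_eq [NullSingletonClass ν] {t : ℝ} (ht : ν (Ioi t) ≠ 0) :
    (ν (Ioi t))⁻¹ = 1 + ∫⁻ x in Iic t, (ν (Ioi x))⁻¹ ^ 2 ∂ν := by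
  have hlt : cdf ν t < 1 := by
    rw [← ofReal_one_sub_cdf] at ht
    linarith [ENNReal.ofReal_pos.1 (pos_iff_ne_zero.2 ht)]
  have h := setLIntegral_Iic_comp_cdf ν (g := fun u => (1 - ENNReal.ofReal u)⁻¹ ^ 2)
    (by fun_prop) hlt
  simp only [one_sub_ofReal_cdf] at h
  rw [h, setLIntegral_Icc_inv_one_sub_sq (cdf_nonneg ν t) hlt, ← ofReal_one_sub_cdf,
    ← ENNReal.ofReal_one, ← ENNReal.ofReal_add zero_le_one,
    ← ENNReal.ofReal_inv_of_pos (by linarith)]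
  · congr 1
    ring
  · have : 1 ≤ (1 - cdf ν t)⁻¹ := (one_le_inv₀ (by linarith)).2 (by linarith [cdf_nonneg ν t])
    linarith

/-- Expanding the geometric series and integrating termwise leaves the harmonic series. -/
theorem setLIntegral_Icc_inv_one_sub :
    ∫⁻ u in Icc (0 : ℝ) 1, (1 - ENNReal.ofReal u)⁻¹ = ∞ := by
  have hpow : ∀ n : ℕ, ∫⁻ u in Icc (0 : ℝ) 1, ENNReal.ofReal u ^ n =
      ENNReal.ofReal (1 / ((n : ℝ) + 1)) := by
    intro n
    have h : ∫ u in Icc (0 : ℝ) 1, u ^ n = 1 / ((n : ℝ) + 1) := by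
      rw [integral_Icc_eq_integral_Ioc, ← intervalIntegral.integral_of_le zero_le_one,
        integral_pow]
      simp
    rw [← h, ofReal_integral_eq_lintegral_ofReal]
    · exact setLIntegral_congr_fun measurableSet_Icc fun u hu => (ENNReal.ofReal_pow hu.1 n).symm
    · exact (continuous_pow n).continuousOn.integrableOn_compact isCompact_Icc
    · filter_upwards [ae_restrict_mem measurableSet_Icc] with u hu
      exact pow_nonneg hu.1 n
  simp only [← ENNReal.tsum_geometric]
  rw [lintegral_tsum fun n => by fun_prop]
  simp only [hpow]
  by_contra hcon
  have hs := ENNReal.summable_toReal hcon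
  refine Real.not_summable_one_div_natCast ((summable_nat_add_iff 1).1 (hs.congr fun n => ?_))
  rw [ENNReal.toReal_ofReal (by positivity)]
  push_cast
  rfl

end ProbabilityIntegralTransform

/-! ### Tail sums and expectations -/

section TailSums

theorem tsum_indicator_natCast_le (z : ℝ) :
    ∑' k : ℕ, {k : ℕ | (k : ℝ) ≤ z}.indicator (fun _ => (1 : ℝ≥0∞)) k ≤ ENNReal.ofReal z + 1 := by
  rw [← tsum_subtype, ENNReal.tsum_set_one]
  have hsub : {k : ℕ | (k : ℝ) ≤ z} ⊆ (Finset.range (⌊z⌋₊ + 1) : Finset ℕ) := by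
    intro k hk
    simpa [Nat.lt_succ_iff] using Nat.le_floor hk
  by_cases hz : 0 ≤ z
  · have h := ENat.toENNReal_le.2 (Set.encard_le_encard hsub)
    rw [Set.encard_coe_eq_coe_finsetCard, Finset.card_range] at h
    refine h.trans ?_
    push_cast
    gcongr
    rw [← ENNReal.ofReal_natCast]
    exact ENNReal.ofReal_le_ofReal (Nat.floor_le hz)
  · have : {k : ℕ | (k : ℝ) ≤ z} = ∅ := by
      ext k
      simp only [mem_ofPred_eq, mem_empty_iff_false, iff_false]
      intro hk
      exact hz (le_trans (Nat.cast_nonneg k) hk)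
    simp [this]

theorem ofReal_le_tsum_indicator_natCast (z : ℝ) :
    ENNReal.ofReal z ≤ ∑' k : ℕ, {k : ℕ | (k : ℝ) < z}.indicator (fun _ => (1 : ℝ≥0∞)) k := by
  rw [← tsum_subtype, ENNReal.tsum_set_one]
  have hset : {k : ℕ | (k : ℝ) < z} = (Finset.range ⌈z⌉₊ : Finset ℕ) := by
    ext k
    simp [Nat.lt_ceil]
  rw [hset, Set.encard_coe_eq_coe_finsetCard, Finset.card_range]
  simp only [ENat.toENNReal_coe]
  rw [← ENNReal.ofReal_natCast]
  exact ENNReal.ofReal_le_ofReal (Nat.le_ceil z)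

variable (ν : Measure ℝ) [IsProbabilityMeasure ν]

/-- For fixed `x`, the number of `k` with `a * k + K ≤ x` is at most `x⁺ / a` plus a constant;
integrate over `x`. -/
theorem tsum_measure_Ici_lt_top (h : ∫⁻ x, ENNReal.ofReal x ∂ν < ∞) {a : ℝ} (ha : 0 < a)
    (K : ℝ) : ∑' k : ℕ, ν (Ici (a * k + K)) < ∞ := by
  have hpt : ∀ x : ℝ, ∑' k : ℕ, (Ici (a * k + K)).indicator (fun _ => (1 : ℝ≥0∞)) x ≤
      ENNReal.ofReal a⁻¹ * ENNReal.ofReal x + (ENNReal.ofReal (-K / a) + 1) := by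
    intro x
    have h1 : ∀ k : ℕ, (Ici (a * k + K)).indicator (fun _ => (1 : ℝ≥0∞)) x =
        {k : ℕ | (k : ℝ) ≤ (x - K) / a}.indicator (fun _ => (1 : ℝ≥0∞)) k := by
      intro k
      simp only [indicator_apply, mem_Ici, mem_ofPred_eq]
      congr 1
      rw [le_div_iff₀ ha]
      exact propext ⟨fun h => by linarith, fun h => by linarith⟩
    simp only [h1]
    refine (tsum_indicator_natCast_le _).trans ?_
    rw [← add_assoc, ← ENNReal.ofReal_mul (inv_nonneg.2 ha.le)]
    gcongr
    have : (x - K) / a = a⁻¹ * x + -K / a := by field_simp; ring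
    rw [this]
    exact ENNReal.ofReal_add_le
  calc ∑' k : ℕ, ν (Ici (a * k + K))
      = ∫⁻ x, ∑' k : ℕ, (Ici (a * k + K)).indicator (fun _ => (1 : ℝ≥0∞)) x ∂ν := by
        rw [lintegral_tsum fun k =>
          (measurable_const.indicator measurableSet_Ici).aemeasurable]
        simp [lintegral_indicator measurableSet_Ici]
    _ ≤ ∫⁻ x, (ENNReal.ofReal a⁻¹ * ENNReal.ofReal x + (ENNReal.ofReal (-K / a) + 1)) ∂ν :=
        lintegral_mono hpt
    _ = ENNReal.ofReal a⁻¹ * ∫⁻ x, ENNReal.ofReal x ∂ν + (ENNReal.ofReal (-K / a) + 1) := by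
        rw [lintegral_add_right _ measurable_const,
          lintegral_const_mul _ ENNReal.measurable_ofReal]
        simp
    _ < ∞ := by
        have := ENNReal.mul_lt_top (ENNReal.ofReal_lt_top (r := a⁻¹)) h
        simp [this.ne, lt_top_iff_ne_top]

theorem tsum_measure_Ioi_eq_top (h : ∫⁻ x, ENNReal.ofReal x ∂ν = ∞) {a : ℝ} (ha : 0 < a)
    (K : ℝ) : ∑' k : ℕ, ν (Ioi (a * k + K)) = ∞ := by
  have hpt : ∀ x : ℝ, ENNReal.ofReal x ≤ ENNReal.ofReal a *
      (∑' k : ℕ, (Ioi (a * k + K)).indicator (fun _ => (1 : ℝ≥0∞)) x) + ENNReal.ofReal K := by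
    intro x
    have h1 : ∀ k : ℕ, (Ioi (a * k + K)).indicator (fun _ => (1 : ℝ≥0∞)) x =
        {k : ℕ | (k : ℝ) < (x - K) / a}.indicator (fun _ => (1 : ℝ≥0∞)) k := by
      intro k
      simp only [indicator_apply, mem_Ioi, mem_ofPred_eq]
      congr 1
      rw [lt_div_iff₀ ha]
      exact propext ⟨fun h => by linarith, fun h => by linarith⟩
    simp only [h1]
    have hx : x = a * ((x - K) / a) + K := by field_simp; ring
    calc ENNReal.ofReal x = ENNReal.ofReal (a * ((x - K) / a) + K) := by rw [← hx]
      _ ≤ ENNReal.ofReal (a * ((x - K) / a)) + ENNReal.ofReal K := ENNReal.ofReal_add_le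
      _ = ENNReal.ofReal a * ENNReal.ofReal ((x - K) / a) + ENNReal.ofReal K := by
        rw [ENNReal.ofReal_mul ha.le]
      _ ≤ _ := by
        gcongr
        exact ofReal_le_tsum_indicator_natCast _
  have hle := lintegral_mono (μ := ν) hpt
  have hmeas : Measurable fun x : ℝ =>
      ∑' k : ℕ, (Ioi (a * k + K)).indicator (fun _ => (1 : ℝ≥0∞)) x :=
    Measurable.tsum fun k => measurable_const.indicator measurableSet_Ioi
  rw [h, lintegral_add_right _ measurable_const, lintegral_const_mul _ hmeas,
    lintegral_tsum fun k => (measurable_const.indicator measurableSet_Ioi).aemeasurable] at hle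
  simp only [lintegral_indicator measurableSet_Ioi, lintegral_const, measure_univ, mul_one, one_mul,
    Measure.restrict_apply_univ] at hle
  by_contra hcon
  have := ENNReal.mul_lt_top (ENNReal.ofReal_lt_top (r := a)) (lt_top_iff_ne_top.2 hcon)
  exact absurd hle (not_le.2 (ENNReal.add_lt_top.2 ⟨this, ENNReal.ofReal_lt_top⟩))

end TailSums

theorem ENNReal.tsum_nat_add_eq_top {f : ℕ → ℝ≥0∞} (hf : ∀ n, f n ≠ ∞) (h : ∑' n, f n = ∞)
    (m : ℕ) : ∑' n, f (n + m) = ∞ := by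
  induction m with
  | zero => simpa using h
  | succ m ih =>
    have := ENNReal.tsum_add_one_eq_top ih (hf _)
    simpa [add_assoc, add_comm 1 m] using this

/-- Weierstrass product inequality. -/
theorem ENNReal.one_le_prod_add_sum {a b : ℕ → ℝ≥0∞} (h : ∀ k, a k + b k = 1) (n : ℕ) :
    1 ≤ ∏ k ∈ Finset.range n, b k + ∑ k ∈ Finset.range n, a k := by
  induction n with
  | zero => simp
  | succ n ih =>
    rw [Finset.prod_range_succ, Finset.sum_range_succ]
    have hprod : ∏ k ∈ Finset.range n, b k ≤ 1 :=
      Finset.prod_le_one' fun k _ => h k ▸ le_add_self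
    calc (1 : ℝ≥0∞) ≤ (∏ k ∈ Finset.range n, b k) * (a n + b n) +
          ∑ k ∈ Finset.range n, a k := by rw [h, mul_one]; exact ih
      _ = (∏ k ∈ Finset.range n, b k) * b n +
          (∑ k ∈ Finset.range n, a k + (∏ k ∈ Finset.range n, b k) * a n) := by ring
      _ ≤ _ := by
        gcongr
        exact mul_le_of_le_one_left' hprod

/-! ### Drift and heavy tails -/

section Drift

open Filter

theorem measurable_measure_Ioi (ν : Measure ℝ) : Measurable fun x => ν (Ioi x) :=
  Antitone.measurable fun _ _ h => measure_mono (Ioi_subset_Ioi h)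

theorem exists_measure_Ioi_ne_zero (ν : Measure ℝ) [IsProbabilityMeasure ν] :
    ∃ x, ν (Ioi x) ≠ 0 := by
  by_contra! hcon
  have huniv : (univ : Set ℝ) = ⋃ n : ℕ, Ioi (-(n : ℝ)) := by
    ext x
    obtain ⟨n, hn⟩ := exists_nat_gt (-x)
    simpa using ⟨n, by linarith⟩
  have h0 : ν univ = 0 := by
    rw [huniv]
    exact measure_iUnion_null fun n => hcon _
  simp at h0

variable {Ω : Type*} [MeasurableSpace Ω] {μ : Measure Ω} [IsProbabilityMeasure μ]
  {X : ℕ → Ω → ℝ} {ν : Measure ℝ} [IsProbabilityMeasure ν]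

/-- Only positive probability is needed: on `X 0 > x`, a record at a late `n` would force `X n`
above a level that Borel–Cantelli allows only finitely often. -/
theorem lintegral_totalDeltaRecords_lt_top_of_neg (hX : ∀ n, Measurable (X n))
    (hindep : iIndepFun X μ) (hlaw : ∀ n, μ.map (X n) = ν)
    (hmean : ∫⁻ x, ENNReal.ofReal x ∂ν < ∞) {c : ℝ} (hc : c < 0) (δ : ℝ) :
    ∫⁻ ω, totalDeltaRecords δ (fun k => linearDrift X c k ω) ∂μ < ∞ := by
  refine lintegral_totalDeltaRecords_lt_top hX hindep hlaw c δ ?_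
  obtain ⟨x, hx⟩ := exists_measure_Ioi_ne_zero ν
  have hsum := tsum_measure_Ici_lt_top ν hmean (neg_pos.2 hc) (x + δ)
  have hBC : ∀ᵐ ω ∂μ, ∀ᶠ n in atTop, ω ∉ X n ⁻¹' Ici (-c * n + (x + δ)) := by
    refine ae_eventually_notMem ?_
    simp only [← Measure.map_apply (hX _) measurableSet_Ici, hlaw]
    exact hsum.ne
  have hsub : ∀ᵐ ω ∂μ, ω ∈ X 0 ⁻¹' Ioi x →
      ω ∈ {ω | totalDeltaRecords δ (fun k => linearDrift X c k ω) < ∞} := by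
    filter_upwards [hBC] with ω hω hω0
    obtain ⟨N, hN⟩ := eventually_atTop.1 hω
    refine totalDeltaRecords_lt_top_iff.2 ((finite_Iic N).subset fun n hn => ?_)
    by_contra hNn
    have hNn : N < n := by simpa using hNn
    have h1 := hN n hNn.le
    have h2 := hn 0 (by omega)
    simp only [linearDrift, mem_preimage, mem_Ici, not_le, mem_Ioi] at h1 h2 hω0
    push_cast at h2
    nlinarith
  intro h0
  apply hx
  rw [← hlaw 0, Measure.map_apply (hX 0) measurableSet_Ioi]
  exact le_antisymm ((measure_mono_ae hsub).trans h0.le) zero_le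

theorem ae_infinite_isDeltaRecord (hX : ∀ n, Measurable (X n))
    (hindep : iIndepFun X μ) (hlaw : ∀ n, μ.map (X n) = ν)
    (hmean : ∫⁻ x, ENNReal.ofReal x ∂ν = ∞) {c : ℝ} (hc : c < 0) :
    ∀ᵐ ω ∂μ, {k | IsDeltaRecord 0 (fun k => linearDrift X c k ω) k}.Infinite := by
  have hBC : ∀ K : ℕ, ∀ᵐ ω ∂μ, ∃ᶠ n in atTop, ω ∈ X n ⁻¹' Ioi (-c * n + K) := by
    intro K
    have hm : ∀ n : ℕ, MeasurableSet (X n ⁻¹' Ioi (-c * n + K)) :=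
      fun n => hX n measurableSet_Ioi
    have h1 : μ (limsup (fun n : ℕ => X n ⁻¹' Ioi (-c * n + K)) atTop) = 1 := by
      refine measure_limsup_eq_one hm ?_ ?_
      · rw [iIndepSet_iff_meas_biInter hm]
        exact fun s => hindep.measure_inter_preimage_eq_mul s fun _ _ => measurableSet_Ioi
      · simp only [← Measure.map_apply (hX _) measurableSet_Ioi, hlaw]
        exact tsum_measure_Ioi_eq_top ν hmean (neg_pos.2 hc) K
    have h2 : ∀ᵐ ω ∂μ, ω ∈ limsup (fun n : ℕ => X n ⁻¹' Ioi (-c * n + K)) atTop :=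
      (mem_ae_iff_prob_eq_one (MeasurableSet.measurableSet_limsup hm)).2 h1
    filter_upwards [h2] with ω hω
    rwa [mem_limsup_iff_frequently_mem] at hω
  filter_upwards [ae_all_iff.2 hBC] with ω hω
  refine infinite_isDeltaRecord le_rfl fun N => ?_
  obtain ⟨B, hB⟩ := (finite_Iic N).image (fun i => linearDrift X c i ω) |>.bddAbove
  -- `X n > -c * n + K` puts the observation above `K + c`, hence above `B`.
  obtain ⟨K, hK⟩ := exists_nat_gt (B - c)
  obtain ⟨n, hn⟩ := (hω K).exists
  refine ⟨n, fun i hi => ?_⟩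
  have h1 : linearDrift X c i ω ≤ B := hB (mem_image_of_mem _ hi)
  have h2 : -c * n + K < X n ω := hn
  refine h1.trans_lt ?_
  simp only [linearDrift]
  linarith

theorem lintegral_totalDeltaRecords_eq_top_of_heavy_tail (hX : ∀ n, Measurable (X n))
    (hindep : iIndepFun X μ) (hlaw : ∀ n, μ.map (X n) = ν)
    (hmean : ∫⁻ x, ENNReal.ofReal x ∂ν = ∞) (c δ : ℝ) :
    ∫⁻ ω, totalDeltaRecords δ (fun k => linearDrift X c k ω) ∂μ = ∞ := by
  -- Lowering the drift only removes records, and a strictly negative one can later pay for `δ`.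
  set c' := min c (-1) with hc'
  have hneg : c' < 0 := (min_le_right _ _).trans_lt (by norm_num)
  have hle : ∫⁻ ω, totalDeltaRecords δ (fun k => linearDrift X c' k ω) ∂μ ≤
      ∫⁻ ω, totalDeltaRecords δ (fun k => linearDrift X c k ω) ∂μ :=
    lintegral_mono fun ω => totalDeltaRecords_mono fun n =>
      IsDeltaRecord.linearDrift_mono (min_le_left _ _)
  refine top_unique (le_trans ?_ hle)
  have h0 := lintegral_totalDeltaRecords_eq_top c' 0
    (ae_infinite_isDeltaRecord hX hindep hlaw hmean hneg)
  rw [lintegral_totalDeltaRecords μ (measurable_linearDrift hX c')] at h0 ⊢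
  -- Over `m` steps the drift costs at least `δ`. Dropping the `m` nearest comparisons therefore
  -- bounds the probability of a `0`-record at `n + m` by that of a `δ`-record at `n`.
  obtain ⟨m, hm⟩ := exists_nat_gt (δ / -c')
  have hm' : c' * m ≤ -δ := by
    rw [div_lt_iff₀ (neg_pos.2 hneg)] at hm
    linarith
  rw [← ENNReal.tsum_nat_add_eq_top (fun n => measure_ne_top _ _) h0 m]
  refine ENNReal.tsum_le_tsum fun n => ?_
  simp only [measure_isDeltaRecord hX hindep hlaw]
  refine lintegral_mono fun x => ?_
  rw [add_comm n m, Finset.prod_range_add]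
  refine (mul_le_of_le_one_left' (Finset.prod_le_one' fun k _ => prob_le_one)).trans ?_
  refine Finset.prod_le_prod' fun k _ => measure_mono (Iio_subset_Iio ?_)
  push_cast
  linarith

/-- With a finite right tail, the failure probabilities against ever older observations are
summable. The product of success probabilities then has a positive lower bound, uniform in `n` and
in a last variable above `x`. -/
theorem lintegral_totalDeltaRecords_eq_top_of_pos (hX : ∀ n, Measurable (X n))
    (hindep : iIndepFun X μ) (hlaw : ∀ n, μ.map (X n) = ν) {c δ x : ℝ} (hc : 0 < c)
    (hIoi : ν (Ioi x) ≠ 0) (hIio : ν (Iio (x - δ + c)) ≠ 0) :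
    ∫⁻ ω, totalDeltaRecords δ (fun k => linearDrift X c k ω) ∂μ = ∞ := by
  rcases eq_top_or_lt_top (∫⁻ x, ENNReal.ofReal x ∂ν) with hmean | hmean
  · exact lintegral_totalDeltaRecords_eq_top_of_heavy_tail hX hindep hlaw hmean c δ
  set a : ℕ → ℝ≥0∞ := fun k => ν (Ici (c * k + (x - δ + c))) with ha
  set b : ℕ → ℝ≥0∞ := fun k => ν (Iio (c * k + (x - δ + c))) with hb
  have hab : ∀ k, a k + b k = 1 := by
    intro k
    simp only [ha, hb, ← compl_Iio]
    rw [add_comm, prob_add_prob_compl measurableSet_Iio]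
  have hsum : ∑' k, a k ≠ ∞ := (tsum_measure_Ici_lt_top ν hmean hc _).ne
  obtain ⟨m, hm⟩ := ((ENNReal.tendsto_sum_nat_add a hsum).eventually
    (gt_mem_nhds (show (0 : ℝ≥0∞) < 2⁻¹ by simp))).exists
  have htail : ∀ n, (2⁻¹ : ℝ≥0∞) ≤ ∏ k ∈ Finset.range n, b (m + k) := by
    intro n
    have h1 := ENNReal.one_le_prod_add_sum (fun k => hab (m + k)) n
    have h2 : ∑ k ∈ Finset.range n, a (m + k) ≤ 2⁻¹ := by
      refine le_trans (ENNReal.sum_le_tsum _) (le_trans (le_of_eq ?_) hm.le)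
      simp only [add_comm m]
    rw [← ENNReal.inv_two_add_inv_two] at h1
    exact (ENNReal.add_le_add_iff_right (by simp)).1 (h1.trans (by gcongr))
  -- As `c > 0`, the lag-one factor is the smallest, and `hIio` makes it positive.
  have hhead : ∏ k ∈ Finset.range m, b k ≠ 0 := by
    refine Finset.prod_ne_zero_iff.2 fun k _ h0 => hIio (measure_mono_null ?_ h0)
    refine Iio_subset_Iio ?_
    have : 0 ≤ c * k := by positivity
    linarith
  set ε : ℝ≥0∞ := (∏ k ∈ Finset.range m, b k) * 2⁻¹ * ν (Ioi x) with hε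
  have hε0 : ε ≠ 0 := mul_ne_zero (mul_ne_zero hhead (by simp)) hIoi
  have hbound : ∀ n, ε ≤ μ {ω | IsDeltaRecord δ (fun k => linearDrift X c k ω) (n + m)} := by
    intro n
    rw [measure_isDeltaRecord hX hindep hlaw]
    calc ε = ∫⁻ _ in Ioi x, (∏ k ∈ Finset.range m, b k) * 2⁻¹ ∂ν := by simp [hε]
      _ ≤ ∫⁻ y in Ioi x, ∏ k ∈ Finset.range (n + m), ν (Iio (y - δ + c * ((k : ℝ) + 1))) ∂ν := by
        refine setLIntegral_mono' measurableSet_Ioi fun y hy => ?_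
        have hy' : x < y := hy
        calc (∏ k ∈ Finset.range m, b k) * 2⁻¹
            ≤ (∏ k ∈ Finset.range m, b k) * ∏ k ∈ Finset.range n, b (m + k) := by
              gcongr
              exact htail n
          _ = ∏ k ∈ Finset.range (n + m), b k := by rw [add_comm n m, Finset.prod_range_add]
          _ ≤ _ := by
            refine Finset.prod_le_prod' fun k _ => measure_mono (Iio_subset_Iio ?_)
            linarith
      _ ≤ _ := setLIntegral_le_lintegral _ _
  rw [lintegral_totalDeltaRecords μ (measurable_linearDrift hX c)]
  refine top_unique ?_
  calc (∞ : ℝ≥0∞) = ∑' _ : ℕ, ε := (ENNReal.tsum_const_eq_top_of_ne_zero hε0).symm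
    _ ≤ ∑' n, μ {ω | IsDeltaRecord δ (fun k => linearDrift X c k ω) (n + m)} :=
        ENNReal.tsum_le_tsum hbound
    _ ≤ _ := ENNReal.tsum_comp_le_tsum_of_injective (add_left_injective m)
        fun n => μ {ω | IsDeltaRecord δ (fun k => linearDrift X c k ω) n}

/-! ### No drift -/

theorem lintegral_totalDeltaRecords_zero_drift [NullSingletonClass ν]
    (hX : ∀ n, Measurable (X n)) (hindep : iIndepFun X μ) (hlaw : ∀ n, μ.map (X n) = ν) (δ : ℝ) :
    ∫⁻ ω, totalDeltaRecords δ (fun k => linearDrift X 0 k ω) ∂μ =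
      ∫⁻ y, (ν (Ioi (y - δ)))⁻¹ ∂ν := by
  have hmono : Measurable fun y : ℝ => ν (Iio (y - δ)) :=
    Monotone.measurable fun _ _ h => measure_mono (Iio_subset_Iio (by linarith))
  rw [lintegral_totalDeltaRecords μ (measurable_linearDrift hX 0)]
  simp only [measure_isDeltaRecord hX hindep hlaw, zero_mul, add_zero, Finset.prod_const,
    Finset.card_range]
  rw [← lintegral_tsum fun n => (hmono.pow_const n).aemeasurable]
  refine lintegral_congr fun y => ?_
  rw [ENNReal.tsum_geometric, ← prob_compl_eq_one_sub measurableSet_Iio, compl_Iio,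
    measure_congr Ioi_ae_eq_Ici]

theorem lintegral_totalDeltaRecords_zero_drift_eq_top [NullSingletonClass ν]
    (hX : ∀ n, Measurable (X n)) (hindep : iIndepFun X μ) (hlaw : ∀ n, μ.map (X n) = ν) {δ : ℝ}
    (hδ : δ ≤ 0) :
    ∫⁻ ω, totalDeltaRecords δ (fun k => linearDrift X 0 k ω) ∂μ = ∞ := by
  rw [lintegral_totalDeltaRecords_zero_drift hX hindep hlaw]
  have h := lintegral_comp_cdf ν (g := fun u => (1 - ENNReal.ofReal u)⁻¹) (by fun_prop)
  rw [setLIntegral_Icc_inv_one_sub] at h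
  simp only [one_sub_ofReal_cdf] at h
  refine top_unique (h.symm.le.trans (lintegral_mono fun y => ?_))
  exact ENNReal.inv_le_inv.2 (measure_mono (Ioi_subset_Ioi (by linarith)))

/-- Substitute the integral form of `(ν (Ioi t))⁻¹` and exchange the integrals over `x ≤ y - δ`. -/
theorem lintegral_inv_measure_Ioi_eq [NullSingletonClass ν] {δ : ℝ}
    (hpos : ∀ᵐ y ∂ν, ν (Ioi (y - δ)) ≠ 0) :
    ∫⁻ y, (ν (Ioi (y - δ)))⁻¹ ∂ν =
      1 + ∫⁻ x, ν (Ioi (x + δ)) * (ν (Ioi x))⁻¹ ^ 2 ∂ν := by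
  set g : ℝ → ℝ≥0∞ := fun x => (ν (Ioi x))⁻¹ ^ 2 with hg
  have hgm : Measurable g := (measurable_measure_Ioi ν).inv.pow_const 2
  have hsetm : MeasurableSet {p : ℝ × ℝ | p.2 ≤ p.1 - δ} :=
    measurableSet_le measurable_snd (measurable_fst.sub_const δ)
  calc ∫⁻ y, (ν (Ioi (y - δ)))⁻¹ ∂ν
      = ∫⁻ y, (1 + ∫⁻ x, {p : ℝ × ℝ | p.2 ≤ p.1 - δ}.indicator (fun p => g p.2) (y, x) ∂ν) ∂ν := by
        refine lintegral_congr_ae ?_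
        filter_upwards [hpos] with y hy
        rw [inv_measure_Ioi_eq ν hy, ← lintegral_indicator measurableSet_Iic]
        rfl
    _ = 1 + ∫⁻ x, ∫⁻ y, {p : ℝ × ℝ | p.2 ≤ p.1 - δ}.indicator (fun p => g p.2) (y, x) ∂ν ∂ν := by
        rw [lintegral_add_left measurable_const, lintegral_lintegral_swap
          (f := fun y x => {p : ℝ × ℝ | p.2 ≤ p.1 - δ}.indicator (fun p => g p.2) (y, x))
          ((hgm.comp measurable_snd).indicator hsetm).aemeasurable]
        simp
    _ = 1 + ∫⁻ x, ν (Ioi (x + δ)) * g x ∂ν := by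
        congr 1
        refine lintegral_congr fun x => ?_
        have h1 : ∀ y, {p : ℝ × ℝ | p.2 ≤ p.1 - δ}.indicator (fun p => g p.2) (y, x) =
            (Ici (x + δ)).indicator (fun _ => g x) y := by
          intro y
          simp only [indicator_apply, mem_ofPred_eq, mem_Ici]
          congr 1
          exact propext ⟨fun h => by linarith, fun h => by linarith⟩
        simp only [h1]
        rw [lintegral_indicator measurableSet_Ici, setLIntegral_const,
          measure_congr (Ioi_ae_eq_Ici (μ := ν) (a := x + δ)).symm, mul_comm]

end Drift

/-! ### Laws with a density positive exactly on an interval -/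

section Density

variable {f : ℝ → ℝ} {xm xp : EReal}

theorem lintegral_ofReal_withDensity (hf : Measurable f) :
    ∫⁻ x, ENNReal.ofReal x ∂(volume.withDensity fun x => ENNReal.ofReal (f x)) =
      rightTailExpectation f := by
  rw [lintegral_withDensity_eq_lintegral_mul _ hf.ennreal_ofReal ENNReal.measurable_ofReal,
    rightTailExpectation, ← lintegral_indicator measurableSet_Ioi]
  refine lintegral_congr fun x => ?_
  by_cases hx : 0 < x
  · simp only [Pi.mul_apply, indicator_of_mem (mem_Ioi.2 hx)]
    rw [ENNReal.ofReal_mul hx.le, mul_comm]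
  · simp [hx, ENNReal.ofReal_of_nonpos (not_lt.1 hx)]

theorem ae_mem_support_withDensity (hf : Measurable f)
    (hzero : ∀ x : ℝ, ¬ (xm < (x : EReal) ∧ (x : EReal) < xp) → f x = 0) :
    ∀ᵐ x : ℝ ∂(volume.withDensity fun x => ENNReal.ofReal (f x)), xm < x ∧ (x : EReal) < xp := by
  rw [ae_withDensity_iff hf.ennreal_ofReal]
  refine Filter.Eventually.of_forall fun x hx => ?_
  by_contra hcon
  exact hx (by simp [hzero x hcon])

theorem measure_Ioo_withDensity_ne_zero (hf : Measurable f)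
    (hpos : ∀ x : ℝ, xm < (x : EReal) → (x : EReal) < xp → 0 < f x) {a b : ℝ} (hab : a < b)
    (ha : xm < a) (hb : b < xp) :
    (volume.withDensity fun x => ENNReal.ofReal (f x)) (Ioo a b) ≠ 0 := by
  rw [Ne, withDensity_apply_eq_zero' hf.ennreal_ofReal.aemeasurable]
  have hsub : Ioo a b ⊆ {x | ENNReal.ofReal (f x) ≠ 0} ∩ Ioo a b := by
    intro x hx
    refine ⟨?_, hx⟩
    have h1 : xm < (x : EReal) := ha.trans (EReal.coe_lt_coe_iff.2 hx.1)
    have h2 : (x : EReal) < xp := (EReal.coe_lt_coe_iff.2 hx.2).trans hb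
    simpa using hpos x h1 h2
  intro h0
  have := measure_mono_null hsub h0
  rw [Real.volume_Ioo, ENNReal.ofReal_eq_zero] at this
  linarith

theorem measure_Ioi_withDensity_ne_zero (hf : Measurable f) (hlt : xm < xp)
    (hpos : ∀ x : ℝ, xm < (x : EReal) → (x : EReal) < xp → 0 < f x) {y : ℝ}
    (hy : (y : EReal) < xp) :
    (volume.withDensity fun x => ENNReal.ofReal (f x)) (Ioi y) ≠ 0 := by
  obtain ⟨a, ha, hap⟩ := EReal.exists_between_coe_real (max_lt hlt hy)
  obtain ⟨b, hab, hb⟩ := EReal.exists_between_coe_real hap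
  intro h0
  refine measure_Ioo_withDensity_ne_zero hf hpos (EReal.coe_lt_coe_iff.1 hab)
    ((le_max_left _ _).trans_lt ha) hb (measure_mono_null (fun x hx => ?_) h0)
  have : y < a := EReal.coe_lt_coe_iff.1 ((le_max_right _ _).trans_lt ha)
  exact this.trans hx.1

theorem measure_Iio_withDensity_ne_zero (hf : Measurable f) (hlt : xm < xp)
    (hpos : ∀ x : ℝ, xm < (x : EReal) → (x : EReal) < xp → 0 < f x) {y : ℝ}
    (hy : xm < (y : EReal)) :
    (volume.withDensity fun x => ENNReal.ofReal (f x)) (Iio y) ≠ 0 := by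
  obtain ⟨b, hmb, hb⟩ := EReal.exists_between_coe_real (lt_min hlt hy)
  obtain ⟨a, ha, hab⟩ := EReal.exists_between_coe_real hmb
  intro h0
  refine measure_Ioo_withDensity_ne_zero hf hpos (EReal.coe_lt_coe_iff.1 hab) ha
    (hb.trans_le (min_le_left _ _)) (measure_mono_null (fun x hx => ?_) h0)
  have : b < y := EReal.coe_lt_coe_iff.1 (hb.trans_le (min_le_right _ _))
  exact hx.2.trans this

theorem exists_real_of_lt_sub (hlt : xm < xp) {d : ℝ} (h : (d : EReal) < xp - xm) :
    ∃ x : ℝ, (x : EReal) < xp ∧ xm < ((x - d : ℝ) : EReal) := by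
  induction xm with
  | top => exact absurd hlt not_top_lt
  | bot =>
    obtain ⟨x, -, hx⟩ := EReal.exists_between_coe_real hlt
    exact ⟨x, hx, EReal.bot_lt_coe _⟩
  | coe a =>
    induction xp with
    | bot => exact absurd hlt not_lt_bot
    | top => exact ⟨a + d + 1, EReal.coe_lt_top _, EReal.coe_lt_coe_iff.2 (by linarith)⟩
    | coe b =>
      have h' : d < b - a := by exact_mod_cast h
      obtain ⟨x, h1, h2⟩ := exists_between (show a + d < b by linarith)
      exact ⟨x, EReal.coe_lt_coe_iff.2 h2, EReal.coe_lt_coe_iff.2 (by linarith)⟩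

theorem sub_lt_of_sub_le {d : ℝ} (h : xp - xm ≤ (d : EReal)) {x y : ℝ} (hx : xm < (x : EReal))
    (hy : (y : EReal) < xp) : y - x < d := by
  have h1 : ((y - x : ℝ) : EReal) < xp - xm := by
    rw [EReal.coe_sub]
    exact EReal.sub_lt_sub_of_le_of_gt hy.le hx (EReal.coe_ne_top _) (bot_le.trans_lt hy).ne'
  exact EReal.coe_lt_coe_iff.1 (h1.trans_le h)

/-- On the support `1 - F > 0`, so real and extended division agree; elsewhere `f = 0` kills both
integrands. -/
theorem lintegral_tail_quotient_eq (hf : Measurable f) (hnonneg : ∀ x, 0 ≤ f x) (hlt : xm < xp)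
    (hpos : ∀ x : ℝ, xm < (x : EReal) → (x : EReal) < xp → 0 < f x)
    (hzero : ∀ x : ℝ, ¬ (xm < (x : EReal) ∧ (x : EReal) < xp) → f x = 0)
    {ν : Measure ℝ} [IsProbabilityMeasure ν]
    (hν : ν = volume.withDensity fun x => ENNReal.ofReal (f x)) (δ : ℝ) :
    ∫⁻ x in Ioi (0 : ℝ), ENNReal.ofReal ((1 - cdf ν (x + δ)) / (1 - cdf ν x) ^ 2 * f x) =
      ∫⁻ x in Ioi (0 : ℝ), ν (Ioi (x + δ)) * (ν (Ioi x))⁻¹ ^ 2 ∂ν := by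
  have hmeas : Measurable fun x => ν (Ioi (x + δ)) * (ν (Ioi x))⁻¹ ^ 2 :=
    ((measurable_measure_Ioi ν).comp (measurable_add_const δ)).mul
      ((measurable_measure_Ioi ν).inv.pow_const 2)
  have hR : ∫⁻ x in Ioi (0 : ℝ), ν (Ioi (x + δ)) * (ν (Ioi x))⁻¹ ^ 2 ∂ν =
      ∫⁻ x in Ioi (0 : ℝ), ENNReal.ofReal (f x) * (ν (Ioi (x + δ)) * (ν (Ioi x))⁻¹ ^ 2) := by
    conv_lhs => rw [hν, restrict_withDensity measurableSet_Ioi, ← hν]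
    rw [lintegral_withDensity_eq_lintegral_mul _ hf.ennreal_ofReal hmeas]
    rfl
  rw [hR]
  refine lintegral_congr fun x => ?_
  by_cases hx : xm < (x : EReal) ∧ (x : EReal) < xp
  · have h0 : ν (Ioi x) ≠ 0 := hν ▸ measure_Ioi_withDensity_ne_zero hf hlt hpos hx.2
    have hcdf : 0 < 1 - cdf ν x := by
      rw [← ofReal_one_sub_cdf] at h0
      exact ENNReal.ofReal_pos.1 (pos_iff_ne_zero.2 h0)
    rw [mul_comm, ENNReal.ofReal_mul (hnonneg x), ENNReal.ofReal_div_of_pos (by positivity),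
      ENNReal.ofReal_pow hcdf.le, ofReal_one_sub_cdf, ofReal_one_sub_cdf, div_eq_mul_inv,
      ENNReal.inv_pow]
  · simp [hzero x hx]

theorem lintegral_Iic_tail_quotient_lt_top (hf : Measurable f) (hlt : xm < xp)
    (hpos : ∀ x : ℝ, xm < (x : EReal) → (x : EReal) < xp → 0 < f x)
    (hzero : ∀ x : ℝ, ¬ (xm < (x : EReal) ∧ (x : EReal) < xp) → f x = 0)
    {ν : Measure ℝ} [IsProbabilityMeasure ν]
    (hν : ν = volume.withDensity fun x => ENNReal.ofReal (f x)) {δ : ℝ} (hδ : 0 < δ) :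
    ∫⁻ x in Iic (0 : ℝ), ν (Ioi (x + δ)) * (ν (Ioi x))⁻¹ ^ 2 ∂ν < ∞ := by
  -- `t = 0` works unless `xp ≤ 0`; then `t = xp - δ`, beyond which the numerator vanishes.
  obtain ⟨t, ht, hbound⟩ : ∃ t : ℝ, ν (Ioi t) ≠ 0 ∧ ∀ x ≤ 0, x ≤ t ∨ ν (Ioi (x + δ)) = 0 := by
    by_cases h0 : (0 : EReal) < xp
    · exact ⟨0, hν ▸ measure_Ioi_withDensity_ne_zero hf hlt hpos (by simpa using h0),
        fun x hx => Or.inl hx⟩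
    · induction xp with
      | top => exact absurd (EReal.coe_lt_top 0) h0
      | bot => exact absurd hlt not_lt_bot
      | coe b =>
        refine ⟨b - δ, hν ▸ measure_Ioi_withDensity_ne_zero hf hlt hpos
          (EReal.coe_lt_coe_iff.2 (by linarith)), fun x _ => ?_⟩
        rcases le_or_gt x (b - δ) with h | h
        · exact Or.inl h
        · right
          have hae := ae_mem_support_withDensity hf hzero
          rw [← hν] at hae
          rw [measure_eq_zero_iff_ae_notMem]
          filter_upwards [hae] with y hy hxy
          have h1 : y < b := EReal.coe_lt_coe_iff.1 hy.2
          have h2 : x + δ < y := hxy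
          linarith
  have hle : ∀ x ∈ Iic (0 : ℝ), ν (Ioi (x + δ)) * (ν (Ioi x))⁻¹ ^ 2 ≤ (ν (Ioi t))⁻¹ ^ 2 := by
    intro x hx
    rcases hbound x hx with h | h
    · refine (mul_le_of_le_one_left' prob_le_one).trans ?_
      gcongr
    · simp [h]
  calc ∫⁻ x in Iic (0 : ℝ), ν (Ioi (x + δ)) * (ν (Ioi x))⁻¹ ^ 2 ∂ν
      ≤ ∫⁻ _ in Iic (0 : ℝ), (ν (Ioi t))⁻¹ ^ 2 ∂ν := setLIntegral_mono' measurableSet_Iic hle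
    _ < ∞ := by
      rw [setLIntegral_const]
      exact ENNReal.mul_lt_top (ENNReal.pow_lt_top (ENNReal.inv_lt_top.2 (pos_iff_ne_zero.2 ht)))
        (measure_lt_top _ _)

variable {Ω : Type*} [MeasurableSpace Ω] {μ : Measure Ω} [IsProbabilityMeasure μ]
  {X : ℕ → Ω → ℝ}

/-- Consecutive observations differ by less than `(xp - xm) + c ≤ δ`, so almost surely only the
first is a record. -/
theorem lintegral_totalDeltaRecords_lt_top_of_sub_le (hX : ∀ n, Measurable (X n))
    (hindep : iIndepFun X μ) {ν : Measure ℝ} (hlaw : ∀ n, μ.map (X n) = ν)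
    (hsupp : ∀ᵐ x : ℝ ∂ν, xm < x ∧ (x : EReal) < xp) {c δ : ℝ}
    (h : xp - xm ≤ ((δ - c : ℝ) : EReal)) :
    ∫⁻ ω, totalDeltaRecords δ (fun k => linearDrift X c k ω) ∂μ < ∞ := by
  refine lintegral_totalDeltaRecords_lt_top hX hindep hlaw c δ ?_
  have hall : ∀ᵐ ω ∂μ, ∀ n, xm < (X n ω : EReal) ∧ (X n ω : EReal) < xp :=
    ae_all_iff.2 fun n => ae_of_ae_map (hX n).aemeasurable (hlaw n ▸ hsupp)
  have hfin : ∀ᵐ ω ∂μ, totalDeltaRecords δ (fun k => linearDrift X c k ω) < ∞ := by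
    filter_upwards [hall] with ω hω
    refine totalDeltaRecords_lt_top_iff.2 ((finite_Iic 0).subset fun n hn => ?_)
    by_contra hn0
    obtain ⟨m, rfl⟩ := Nat.exists_eq_succ_of_ne_zero (fun hn' : n = 0 => hn0 hn'.le)
    have h1 := hn m (Nat.lt_succ_self m)
    have h2 := sub_lt_of_sub_le h (hω m).1 (hω (m + 1)).2
    simp only [linearDrift, Nat.succ_eq_add_one] at h1
    push_cast at h1
    linarith
  rw [measure_congr (Filter.eventuallyEq_univ.2 hfin)]
  simp

end Density

/-! ### The three drift regimes assembled -/

theorem theorem3 {Ω : Type*} [MeasurableSpace Ω] (μ : Measure Ω) [IsProbabilityMeasure μ]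
    (X : ℕ → Ω → ℝ) (hX : ∀ n, Measurable (X n)) (hindep : iIndepFun X μ)
    (f : ℝ → ℝ) (hf : Measurable f)
    (hlaw : ∀ n, μ.map (X n) = volume.withDensity (fun x => ENNReal.ofReal (f x)))
    (xm xp : EReal) (hlt : xm < xp)
    (hpos : ∀ x : ℝ, xm < (x : EReal) → (x : EReal) < xp → 0 < f x)
    (hzero : ∀ x : ℝ, ¬ (xm < (x : EReal) ∧ (x : EReal) < xp) → f x = 0)
    (c δ : ℝ) :
    ((∀ᵐ ω ∂μ, totalDeltaRecords δ (fun n => linearDrift X c n ω) < ∞) ↔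
      ((c < 0 ∧ rightTailExpectation f < ∞) ∨
        (c = 0 ∧ 0 < δ ∧
          ∫⁻ x in Ioi (0 : ℝ), ENNReal.ofReal
            ((1 - cdf (μ.map (X 0)) (x + δ)) / (1 - cdf (μ.map (X 0)) x) ^ 2 * f x) < ∞) ∨
        (0 < c ∧ xp - xm ≤ ((δ - c : ℝ) : EReal)))) ∧
    ((∀ᵐ ω ∂μ, totalDeltaRecords δ (fun n => linearDrift X c n ω) < ∞) ↔
      ∫⁻ ω, totalDeltaRecords δ (fun n => linearDrift X c n ω) ∂μ < ∞) := by
  have hiff : (∀ᵐ ω ∂μ, totalDeltaRecords δ (fun n => linearDrift X c n ω) < ∞) ↔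
      ∫⁻ ω, totalDeltaRecords δ (fun n => linearDrift X c n ω) ∂μ < ∞ := by
    constructor
    · intro h
      refine lintegral_totalDeltaRecords_lt_top hX hindep hlaw c δ ?_
      rw [measure_congr (Filter.eventuallyEq_univ.2 h)]
      simp
    · intro h
      exact ae_lt_top (measurable_totalDeltaRecords (measurable_linearDrift hX c) δ) h.ne
  refine ⟨hiff.trans ?_, hiff⟩
  have hnonneg : ∀ x, 0 ≤ f x := fun x => by
    by_cases hx : xm < (x : EReal) ∧ (x : EReal) < xp
    · exact (hpos x hx.1 hx.2).le
    · exact (hzero x hx).ge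
  obtain ⟨ν, hν⟩ : ∃ ν : Measure ℝ, ν = volume.withDensity fun x => ENNReal.ofReal (f x) :=
    ⟨_, rfl⟩
  rw [← hν] at hlaw
  have hprob : IsProbabilityMeasure ν :=
    hlaw 0 ▸ Measure.isProbabilityMeasure_map (hX 0).aemeasurable
  have hatom : NullSingletonClass ν :=
    ⟨fun x => hν ▸ withDensity_absolutelyContinuous _ _ (measure_singleton x)⟩
  have hmean : ∫⁻ x, ENNReal.ofReal x ∂ν = rightTailExpectation f :=
    hν ▸ lintegral_ofReal_withDensity hf
  have hsupp : ∀ᵐ x : ℝ ∂ν, xm < x ∧ (x : EReal) < xp :=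
    hν ▸ ae_mem_support_withDensity hf hzero
  rw [hlaw 0]
  rcases lt_trichotomy c 0 with hc | rfl | hc
  · simp only [hc, hc.ne, hc.not_gt, true_and, false_and, or_false]
    constructor
    · intro h
      by_contra hcon
      have htop := lintegral_totalDeltaRecords_eq_top_of_heavy_tail hX hindep hlaw
        (hmean.trans (not_lt_top_iff.1 hcon)) c δ
      exact h.ne htop
    · intro h
      exact lintegral_totalDeltaRecords_lt_top_of_neg hX hindep hlaw (hmean ▸ h) hc δ
  · simp only [lt_irrefl, true_and, false_and, or_false, false_or]
    rcases le_or_gt δ 0 with hδ | hδ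
    · simp [lintegral_totalDeltaRecords_zero_drift_eq_top hX hindep hlaw hδ, hδ.not_gt]
    · rw [lintegral_totalDeltaRecords_zero_drift hX hindep hlaw, lintegral_inv_measure_Ioi_eq,
        lintegral_tail_quotient_eq hf hnonneg hlt hpos hzero hν,
        ← lintegral_add_compl (μ := ν) _ (measurableSet_Ioi (a := 0)), compl_Ioi]
      -- The half-line `x ≤ 0` always contributes a finite amount, so only the integral over `x > 0`
      -- matters.
      · have hfin := lintegral_Iic_tail_quotient_lt_top hf hlt hpos hzero hν hδ
        simp [ENNReal.add_lt_top, hfin, hδ]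
      · filter_upwards [hsupp] with y hy
        refine hν ▸ measure_Ioi_withDensity_ne_zero hf hlt hpos (lt_trans ?_ hy.2)
        exact EReal.coe_lt_coe_iff.2 (by linarith)
  · simp only [hc, hc.ne', hc.not_gt, true_and, false_and, false_or]
    constructor
    · intro h
      by_contra! hcon
      -- A support longer than `δ - c` leaves mass both above `x` and below `x - (δ - c)`.
      obtain ⟨x, hxp, hxm⟩ := exists_real_of_lt_sub hlt hcon
      refine h.ne (lintegral_totalDeltaRecords_eq_top_of_pos hX hindep hlaw hc
        (hν ▸ measure_Ioi_withDensity_ne_zero hf hlt hpos hxp) ?_)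
      rw [sub_add]
      exact hν ▸ measure_Iio_withDensity_ne_zero hf hlt hpos hxm
    · exact lintegral_totalDeltaRecords_lt_top_of_sub_le hX hindep hlaw hsupp
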